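/- Regard an inverse semigroup as a set $A$ with an associative multiplication and a unary inversion $a\mapsto a^{-1}$ satisfying the identities $$(xy)^{-1}=y^{-1}x^{-1},\quad (x^{-1})^{-1}=x,\quad xx^{-1}x=x,\quad x^{-1}xy^{-1}y=y^{-1}yx^{-1}x;$$ the morphisms of the category of inverse semigroups are the maps that preserve both operations. **Theorem.** Let $\mathcal{C}$ be a full subcategory of the category of inverse semigroups that contains a free inverse semigroup $A_0=W(x_0)$ with one free generator and a free inverse semigroup $A^0=W(x,y)$ with two free generators. Let $\Phi$ be an automorphism of $\mathcal{C}$ (a functor $\mathcal{C}\to\mathcal{C}$ that has a two-sided inverse functor) such that $\Phi(A_0)\cong A_0$ and $\Phi(A^0)\cong A^0$. Then $\Phi$ is inner: there are isomorphisms $f_A:A\to\Phi(A)$ in $\mathcal{C}$, one for every object $A$ of $\mathcal{C}$, such that $\Phi(\mu)=f_B\circ\mu\circ f_A^{-1}$ for every morphism $\mu:A\to B$ of $\mathcal{C}$. -/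

import Mathlib

open CategoryTheory

universe u v w

/-- Inverse semigroups, as the variety of algebras with an associative multiplication and a unary
inversion satisfying the usual identities. -/
class InverseSemigroup (S : Type u) extends Semigroup S, Inv S where
  mul_inv_rev' (x y : S) : (x * y)⁻¹ = y⁻¹ * x⁻¹
  inv_inv' (x : S) : x⁻¹⁻¹ = x
  mul_inv_mul' (x : S) : x * x⁻¹ * x = x
  inv_mul_comm' (x y : S) : x⁻¹ * x * y⁻¹ * y = y⁻¹ * y * x⁻¹ * x

/-- Homomorphisms of inverse semigroups: maps preserving multiplication and inversion. -/
structure InverseSemigroupHom (A : Type u) (B : Type v) [InverseSemigroup A] [InverseSemigroup B]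
    extends A →ₙ* B where
  map_inv' (a : A) : toFun a⁻¹ = (toFun a)⁻¹

namespace InverseSemigroupHom

instance {A : Type u} {B : Type v} [InverseSemigroup A] [InverseSemigroup B] :
    FunLike (InverseSemigroupHom A B) A B where
  coe f := f.toFun
  coe_injective f g h := by
    cases f; cases g
    congr 1
    exact DFunLike.coe_injective h

/-- The identity homomorphism. -/
def id (A : Type u) [InverseSemigroup A] : InverseSemigroupHom A A where
  toMulHom := MulHom.id A
  map_inv' _ := rfl

/-- The composite `g ∘ f`. -/
def comp {A : Type u} {B : Type v} {C : Type w} [InverseSemigroup A] [InverseSemigroup B]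
    [InverseSemigroup C] (g : InverseSemigroupHom B C) (f : InverseSemigroupHom A B) :
    InverseSemigroupHom A C where
  toMulHom := g.toMulHom.comp f.toMulHom
  map_inv' a := (congrArg g.toFun (f.map_inv' a)).trans (g.map_inv' _)

end InverseSemigroupHom

/-- The category of all inverse semigroups (with underlying set in `Type u`) and all their
homomorphisms. The empty inverse semigroup is included. -/
structure InvSemigrp : Type (u + 1) where
  /-- The underlying set. -/
  carrier : Type u
  [str : InverseSemigroup carrier]

namespace InvSemigrp

attribute [instance] InvSemigrp.str

instance : CoeSort InvSemigrp.{u} (Type u) := ⟨InvSemigrp.carrier⟩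

/-- Morphisms of `InvSemigrp`. -/
@[ext]
structure Hom (A B : InvSemigrp.{u}) where
  /-- The underlying homomorphism. -/
  hom' : InverseSemigroupHom A B

instance : Category InvSemigrp.{u} where
  Hom A B := Hom A B
  id A := ⟨InverseSemigroupHom.id A⟩
  comp f g := ⟨g.hom'.comp f.hom'⟩

instance : ConcreteCategory InvSemigrp.{u} (fun A B => InverseSemigroupHom A B) where
  hom := Hom.hom'
  ofHom := Hom.mk

/-- `A` is a free inverse semigroup with the family `x` of free generators: every map from the
index set of the generators to an inverse semigroup `B` extends uniquely to a homomorphism. -/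
def IsFreeOn (A : InvSemigrp.{u}) {X : Type v} (x : X → A) : Prop :=
  ∀ (B : InvSemigrp.{u}) (b : X → B), ∃! g : A ⟶ B, ∀ i, g (x i) = b i

end InvSemigrp

/-- An endofunctor is an automorphism of the category if it has a strict two-sided inverse. -/
def IsCategoryAutomorphism {C : Type u} [Category.{v} C] (Φ : C ⥤ C) : Prop :=
  ∃ Ψ : C ⥤ C, Φ ⋙ Ψ = 𝟭 C ∧ Ψ ⋙ Φ = 𝟭 C

/-- An endofunctor is inner if there are isomorphisms `f A : A ≅ Φ A` such that
`Φ μ = f B ∘ μ ∘ (f A)⁻¹` for every morphism `μ : A ⟶ B`. -/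
def IsInnerFunctor {C : Type u} [Category.{v} C] (Φ : C ⥤ C) : Prop :=
  ∃ f : ∀ A : C, A ≅ Φ.obj A, ∀ {A B : C} (μ : A ⟶ B), Φ.map μ = (f A).inv ≫ μ ≫ (f B).hom

/-! Elements of `A` are the morphisms `A₀ ⟶ A`, so `Φ` and an isomorphism `A₀ ≅ Φ A₀` yield natural
bijections `A → Φ A` (`exists_of_iso`). Pulling back the operations of `Φ A` gives a second inverse
semigroup structure on `A`, defined by words.

The new inversion is the old one, because an involutive endomorphism of `A₀` sends the generator to
itself or to its inverse (`eq_or_eq_inv_of_involutive`). Products of idempotents agree, because a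
binary word on a semilattice is `e`, `f` or `ef`, and only the last is commutative
(`map_mul_of_idem`). The new `aa⁻¹` is then uniformly the old `aa⁻¹` or the old `a⁻¹a`
(`map_dom_or`); composing with inversion reduces the second case to the first. Finally the new
product of the generators `x`, `y` is pinned down by its domain and range and equals `xy`
(`natural_op_eq_mul`). -/

namespace InverseSemigroup

/-! ### Idempotents and partial bijections -/

variable {S : Type u} [InverseSemigroup S]

theorem inv_mul_inv (a : S) : a⁻¹ * a * a⁻¹ = a⁻¹ := by
  simpa only [inv_inv'] using mul_inv_mul' a⁻¹

/-- The idempotents `e⁻¹ * e` and `e * e⁻¹` commute, and their two products reduce to `e⁻¹` and `e`.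
-/
theorem inv_eq_self {e : S} (he : e * e = e) : e⁻¹ = e := by
  have h1 : e⁻¹ * e⁻¹ = e⁻¹ := by rw [← mul_inv_rev', he]
  have h2 : e⁻¹ * e * (e * e⁻¹) = e * e⁻¹ * (e⁻¹ * e) := by
    simpa only [inv_inv', ← mul_assoc] using inv_mul_comm' e e⁻¹
  have h3 : e⁻¹ * e * (e * e⁻¹) = e⁻¹ := by
    rw [← mul_assoc, mul_assoc e⁻¹ e e, he, inv_mul_inv]
  have h4 : e * e⁻¹ * (e⁻¹ * e) = e := by
    rw [← mul_assoc, mul_assoc e e⁻¹ e⁻¹, h1, mul_inv_mul']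
  rw [← h3, h2, h4]

theorem idem_comm {e f : S} (he : e * e = e) (hf : f * f = f) : e * f = f * e := by
  have := inv_mul_comm' e f
  rwa [inv_eq_self he, inv_eq_self hf, he, hf, mul_assoc, hf, mul_assoc, he] at this

theorem mul_inv_idem (a : S) : a * a⁻¹ * (a * a⁻¹) = a * a⁻¹ := by
  rw [← mul_assoc, mul_inv_mul']

theorem inv_mul_idem (a : S) : a⁻¹ * a * (a⁻¹ * a) = a⁻¹ * a := by
  rw [← mul_assoc, inv_mul_inv]

theorem mul_idem {e f : S} (he : e * e = e) (hf : f * f = f) : e * f * (e * f) = e * f := by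
  rw [mul_assoc, ← mul_assoc f, idem_comm hf he, mul_assoc e f f, hf, ← mul_assoc, he]

/-- The inverse semigroup of partial bijections of `α`. -/
instance partialBijections (α : Type) : InverseSemigroup (ULift.{u} (α ≃. α)) where
  mul a b := ⟨a.down.trans b.down⟩
  inv a := ⟨a.down.symm⟩
  mul_assoc a b c := congrArg ULift.up (PEquiv.trans_assoc _ _ _)
  mul_inv_rev' a b := congrArg ULift.up (PEquiv.symm_trans_rev _ _)
  inv_inv' _ := rfl
  mul_inv_mul' a := by
    refine congrArg ULift.up (PEquiv.ext fun i => Option.ext fun j => ?_)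
    change j ∈ ((a.down.trans a.down.symm).trans a.down) i ↔ j ∈ a.down i
    simp only [PEquiv.mem_trans, PEquiv.mem_iff_mem]
    constructor
    · rintro ⟨k, ⟨l, h1, h2⟩, h3⟩
      rwa [a.down.inj h1 h2]
    · exact fun h => ⟨i, ⟨j, h, h⟩, h⟩
  inv_mul_comm' a b := by
    refine congrArg ULift.up (PEquiv.ext fun i => Option.ext fun j => ?_)
    change j ∈ (((a.down.symm.trans a.down).trans b.down.symm).trans b.down) i ↔
      j ∈ (((b.down.symm.trans b.down).trans a.down.symm).trans a.down) i
    simp only [PEquiv.mem_trans, PEquiv.mem_iff_mem]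
    constructor <;>
    · rintro ⟨k, ⟨l, ⟨m, h1, h2⟩, h3⟩, h4⟩
      obtain rfl := Option.mem_unique h1 h2
      obtain rfl := Option.mem_unique h3 h4
      exact ⟨m, ⟨i, ⟨k, h3, h3⟩, h1⟩, h1⟩

theorem partialBijections_mul {α : Type} (a b : ULift.{u} (α ≃. α)) :
    a * b = ⟨a.down.trans b.down⟩ := rfl

theorem partialBijections_inv {α : Type} (a : ULift.{u} (α ≃. α)) :
    a⁻¹ = ⟨a.down.symm⟩ := rfl

end InverseSemigroup

/-! ### Homomorphisms and free inverse semigroups -/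

namespace InvSemigrp

open InverseSemigroup

theorem hom_mul {A B : InvSemigrp.{u}} (f : A ⟶ B) (a b : A) : f (a * b) = f a * f b :=
  f.hom'.map_mul' a b

theorem hom_inv {A B : InvSemigrp.{u}} (f : A ⟶ B) (a : A) : f a⁻¹ = (f a)⁻¹ :=
  f.hom'.map_inv' a

theorem hom_ext' {A B : InvSemigrp.{u}} {f g : A ⟶ B} (h : ∀ a, f a = g a) : f = g :=
  Hom.ext (DFunLike.coe_injective (funext h))

/-- The isomorphism given by a bijective multiplicative map commuting with inversion. -/
def isoOfEquiv {A B : InvSemigrp.{u}} (e : A ≃ B) (hm : ∀ a b, e (a * b) = e a * e b)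
    (hi : ∀ a, e a⁻¹ = (e a)⁻¹) : A ≅ B where
  hom := ⟨{ toFun := e, map_mul' := hm, map_inv' := hi }⟩
  inv := ⟨{ toFun := e.symm
            map_mul' := fun a b => by simp [Equiv.symm_apply_eq, hm]
            map_inv' := fun a => by simp [Equiv.symm_apply_eq, hi] }⟩
  hom_inv_id := hom_ext' e.symm_apply_apply
  inv_hom_id := hom_ext' e.apply_symm_apply

namespace IsFreeOn

variable {A : InvSemigrp.{u}} {X : Type v} {x : X → A}

/-- Induction over the elements of a free inverse semigroup. -/
theorem induction (hA : A.IsFreeOn x) {p : A → Prop} (hx : ∀ i, p (x i))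
    (hm : ∀ a b, p a → p b → p (a * b)) (hi : ∀ a, p a → p a⁻¹) (a : A) : p a := by
  let str : InverseSemigroup {a : A // p a} :=
    { mul := fun a b => ⟨a * b, hm _ _ a.2 b.2⟩
      inv := fun a => ⟨a.1⁻¹, hi _ a.2⟩
      mul_assoc := fun a b c => Subtype.ext (mul_assoc a.1 b.1 c.1)
      mul_inv_rev' := fun a b => Subtype.ext (mul_inv_rev' a.1 b.1)
      inv_inv' := fun a => Subtype.ext (inv_inv' a.1)
      mul_inv_mul' := fun a => Subtype.ext (mul_inv_mul' a.1)
      inv_mul_comm' := fun a b => Subtype.ext (inv_mul_comm' a.1 b.1) }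
  let B : InvSemigrp.{u} := ⟨{a : A // p a}⟩
  let incl : B ⟶ A := ⟨{ toFun := Subtype.val, map_mul' := fun _ _ => rfl, map_inv' := fun _ => rfl }⟩
  obtain ⟨g, hg, -⟩ := hA B (fun i => ⟨x i, hx i⟩)
  have h : g ≫ incl = 𝟙 A := by
    refine (hA A x).unique (fun i => ?_) (fun i => rfl)
    exact congrArg incl (hg i)
  have h2 : (g a).1 = a := congrArg (fun f : A ⟶ A => f a) h
  exact h2 ▸ (g a).2

/-- Every action of the generators by partial bijections extends to the free inverse semigroup. -/
theorem exists_action (hA : A.IsFreeOn x) {α : Type} (b : X → α ≃. α) :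
    ∃ r : A → α → α → Prop, (∀ k i j, r (x k) i j ↔ j ∈ b k i) ∧
      (∀ a c i j, r (a * c) i j ↔ ∃ k, r a i k ∧ r c k j) ∧ (∀ a i j, r a⁻¹ i j ↔ r a j i) := by
  obtain ⟨g, hg, -⟩ := hA ⟨ULift.{u} (α ≃. α)⟩ (fun k => ⟨b k⟩)
  refine ⟨fun a i j => j ∈ (g a).down i, fun k i j => ?_, fun a c i j => ?_, fun a i j => ?_⟩
  · dsimp only
    rw [hg]
  · dsimp only
    rw [hom_mul, partialBijections_mul]
    exact PEquiv.mem_trans _ _ _ _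
  · dsimp only
    rw [hom_inv, partialBijections_inv]
    exact PEquiv.mem_iff_mem _

theorem of_iso (hA : A.IsFreeOn x) {B : InvSemigrp.{u}} (e : A ≅ B) :
    B.IsFreeOn (fun i => e.hom (x i)) := by
  intro C c
  obtain ⟨g, hg, hu⟩ := hA C c
  have hinv : ∀ a, e.inv (e.hom a) = a := fun a => congrArg (fun f : A ⟶ A => f a) e.hom_inv_id
  refine ⟨e.inv ≫ g, fun i => ?_, fun h hh => ?_⟩
  · exact (congrArg g (hinv _)).trans (hg i)
  · rw [← hu (e.hom ≫ h) hh, e.inv_hom_id_assoc]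

end IsFreeOn

end InvSemigrp

namespace InvSemigrp

open InverseSemigroup

namespace IsFreeOn

/-! ### The free monogenic inverse semigroup -/

section Monogenic

variable {A : InvSemigrp.{u}} {x : Fin 1 → A}

theorem exists_action_fin_two (hA : A.IsFreeOn x) :
    ∃ r : A → Fin 2 → Fin 2 → Prop, (∀ i j, r (x 0) i j ↔ i = 0 ∧ j = 1) ∧
      (∀ a c i j, r (a * c) i j ↔ ∃ k, r a i k ∧ r c k j) ∧ (∀ a i j, r a⁻¹ i j ↔ r a j i) := by
  obtain ⟨r, hr, hm, hi⟩ := hA.exists_action (fun _ => PEquiv.single (0 : Fin 2) (1 : Fin 2))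
  exact ⟨r, fun i j => by rw [hr, PEquiv.mem_single_iff], hm, hi⟩

theorem mul_inv_not_le (hA : A.IsFreeOn x) :
    x 0 * (x 0)⁻¹ * ((x 0)⁻¹ * x 0) ≠ x 0 * (x 0)⁻¹ := by
  obtain ⟨r, hr, hm, hi⟩ := hA.exists_action_fin_two
  intro h
  have h1 : r (x 0 * (x 0)⁻¹) 0 0 := by simp [hm, hi, hr]
  rw [← h] at h1
  simp [hm, hi, hr] at h1

theorem inv_ne_self (hA : A.IsFreeOn x) : (x 0)⁻¹ ≠ x 0 := by
  obtain ⟨r, hr, hm, hi⟩ := hA.exists_action_fin_two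
  intro h
  have h1 : r (x 0) 0 1 := by simp [hr]
  rw [← h] at h1
  simp [hi, hr] at h1

/-- An involutive endomorphism of the free monogenic inverse semigroup maps the generator to itself
or to its inverse. -/
theorem eq_or_eq_inv_of_involutive (hA : A.IsFreeOn x) (φ : A ⟶ A) (hφ : φ (φ (x 0)) = x 0) :
    φ (x 0) = x 0 ∨ φ (x 0) = (x 0)⁻¹ := by
  obtain ⟨r, hr, hm, hi⟩ := hA.exists_action_fin_two
  -- Matrix units: by `key`, `d i j` is the only element that maps `i` to `j`.
  let d : Fin 2 → Fin 2 → A := ![![x 0 * (x 0)⁻¹, x 0], ![(x 0)⁻¹, (x 0)⁻¹ * x 0]]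
  have hd : ∀ i j k, d i j * d j k = d i k := by
    simp [Fin.forall_fin_two, d, ← mul_assoc, mul_inv_mul', inv_mul_inv]
  have hd' : ∀ i j, (d i j)⁻¹ = d j i := by
    simp [Fin.forall_fin_two, d, mul_inv_rev', inv_inv']
  have key : ∀ a i j, r a i j → a = d i j := by
    refine hA.induction ?_ ?_ ?_
    · intro k i j h
      rw [Subsingleton.elim k 0, hr] at h
      rw [Subsingleton.elim k 0, h.1, h.2]
      rfl
    · intro a b ha hb i j h
      obtain ⟨k, h1, h2⟩ := (hm _ _ _ _).1 h
      rw [ha _ _ h1, hb _ _ h2, hd]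
    · intro a ha i j h
      rw [ha _ _ ((hi _ _ _).1 h), hd']
  -- Otherwise `φ (x 0)` acts as a restriction of the identity, hence so does the whole image of
  -- `φ`, although `x 0 = φ (φ (x 0))` moves `0`.
  by_contra hcon
  push Not at hcon
  have hdiag : ∀ i j, r (φ (x 0)) i j → i = j := by
    intro i j h
    have := key _ _ _ h
    fin_cases i <;> fin_cases j
    · rfl
    · exact absurd this hcon.1
    · exact absurd this hcon.2
    · rfl
  have hall : ∀ a i j, r (φ a) i j → i = j := by
    refine hA.induction ?_ ?_ ?_
    · intro k
      rw [Subsingleton.elim k 0]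
      exact hdiag
    · intro a b ha hb i j h
      rw [hom_mul, hm] at h
      obtain ⟨k, h1, h2⟩ := h
      exact (ha _ _ h1).trans (hb _ _ h2)
    · intro a ha i j h
      rw [hom_inv, hi] at h
      exact (ha _ _ h).symm
  have := hall (φ (x 0)) 0 1 (by rw [hφ, hr]; exact ⟨rfl, rfl⟩)
  exact absurd this (by decide)

/-- Every word begins with the generator or its inverse. The induction carries the claim for `a⁻¹`
along. -/
theorem mul_inv_mul_or_inv_mul_mul (hA : A.IsFreeOn x) (a : A) :
    x 0 * (x 0)⁻¹ * a = a ∨ (x 0)⁻¹ * x 0 * a = a := by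
  refine (hA.induction (p := fun a => (x 0 * (x 0)⁻¹ * a = a ∨ (x 0)⁻¹ * x 0 * a = a) ∧
    (x 0 * (x 0)⁻¹ * a⁻¹ = a⁻¹ ∨ (x 0)⁻¹ * x 0 * a⁻¹ = a⁻¹)) ?_ ?_ ?_ a).1
  · intro k
    rw [Subsingleton.elim k 0]
    exact ⟨.inl (mul_inv_mul' _), .inr (inv_mul_inv _)⟩
  · intro a b ha hb
    rw [mul_inv_rev', ← mul_assoc, ← mul_assoc, ← mul_assoc, ← mul_assoc]
    exact ⟨ha.1.imp (congrArg (· * b)) (congrArg (· * b)),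
      hb.2.imp (congrArg (· * a⁻¹)) (congrArg (· * a⁻¹))⟩
  · intro a ha
    rw [inv_inv']
    exact ⟨ha.2, ha.1⟩

/-- An idempotent of the free monogenic inverse semigroup that, together with its image under the
inversion of the generator, dominates all idempotents is one of the two maximal ones. -/
theorem eq_mul_inv_or_eq_inv_mul (hA : A.IsFreeOn x) (ι : A ⟶ A) (hι : ι (x 0) = (x 0)⁻¹) {e : A}
    (he : e * e = e) (hmax : e * (x 0 * (x 0)⁻¹) = x 0 * (x 0)⁻¹ ∨
      ι e * (x 0 * (x 0)⁻¹) = x 0 * (x 0)⁻¹) :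
    e = x 0 * (x 0)⁻¹ ∨ e = (x 0)⁻¹ * x 0 := by
  have hιe : ι (ι e) = e := by
    have : ι ≫ ι = 𝟙 A := by
      refine (hA A x).unique (fun i => ?_) (fun i => rfl)
      change ι (ι (x i)) = x i
      rw [Subsingleton.elim i 0, hι, hom_inv, hι, inv_inv']
    exact congrArg (fun f : A ⟶ A => f e) this
  have hp : ι (x 0 * (x 0)⁻¹) = (x 0)⁻¹ * x 0 := by rw [hom_mul, hom_inv, hι, inv_inv']
  have c1 := idem_comm he (mul_inv_idem (x 0))
  have c2 := idem_comm he (inv_mul_idem (x 0))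
  have c3 := idem_comm (mul_inv_idem (x 0)) (inv_mul_idem (x 0))
  have hne := hA.mul_inv_not_le
  rcases hmax with h | h
  · rcases hA.mul_inv_mul_or_inv_mul_mul e with h' | h'
    · exact .inl (by rw [← h', ← c1, h])
    · refine absurd ?_ hne
      rw [c3]
      nth_rw 1 [← h]
      rw [← mul_assoc, h', h]
  · replace h := congrArg ι h
    rw [hom_mul, hp, hιe] at h
    rcases hA.mul_inv_mul_or_inv_mul_mul e with h' | h'
    · have h1 : x 0 * (x 0)⁻¹ * ((x 0)⁻¹ * x 0) = (x 0)⁻¹ * x 0 := by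
        nth_rw 1 [← h]
        rw [← mul_assoc, h', h]
      have h2 := congrArg ι h1
      rw [hom_mul, hp, hom_mul, hom_inv, hι, inv_inv', c3.symm] at h2
      exact absurd h2 hne
    · exact .inr (by rw [← h', ← c2, h])

end Monogenic

/-! ### The free inverse semigroup of rank two -/

section TwoGenerators

variable {A : InvSemigrp.{u}} {x : Fin 2 → A}

theorem exists_hom (hA : A.IsFreeOn x) {B : InvSemigrp.{u}} (a b : B) :
    ∃ g : A ⟶ B, g (x 0) = a ∧ g (x 1) = b := by
  obtain ⟨g, hg, -⟩ := hA B ![a, b]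
  exact ⟨g, hg 0, hg 1⟩

/-- The path `0 → 1 → 2` labelled by the generators is the Munn tree of `x 0 * x 1`. -/
theorem exists_action_fin_three (hA : A.IsFreeOn x) :
    ∃ r : A → Fin 3 → Fin 3 → Prop, (∀ i j, r (x 0) i j ↔ i = 0 ∧ j = 1) ∧
      (∀ i j, r (x 1) i j ↔ i = 1 ∧ j = 2) ∧
      (∀ a c i j, r (a * c) i j ↔ ∃ k, r a i k ∧ r c k j) ∧ (∀ a i j, r a⁻¹ i j ↔ r a j i) := by
  obtain ⟨r, hr, hm, hi⟩ := hA.exists_action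
    ![PEquiv.single (0 : Fin 3) (1 : Fin 3), PEquiv.single (1 : Fin 3) (2 : Fin 3)]
  exact ⟨r, fun i j => by rw [hr]; exact PEquiv.mem_single_iff _ _ _ _,
    fun i j => by rw [hr]; exact PEquiv.mem_single_iff _ _ _ _, hm, hi⟩

theorem mul_inv_ne_mul_inv (hA : A.IsFreeOn x) : x 0 * (x 0)⁻¹ ≠ x 1 * (x 1)⁻¹ := by
  obtain ⟨r, hr, hr', hm, hi⟩ := hA.exists_action_fin_three
  intro h
  have h1 : r (x 0 * (x 0)⁻¹) 0 0 := by simp [hm, hi, hr]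
  rw [h] at h1
  simp [hm, hi, hr'] at h1

theorem not_idem (hA : A.IsFreeOn x) : x 0 * x 0 ≠ x 0 := by
  obtain ⟨r, hr, hr', hm, hi⟩ := hA.exists_action_fin_three
  intro h
  have h1 : r (x 0) 0 1 := by simp [hr]
  rw [← h] at h1
  simp [hm, hr] at h1

/-- A word takes one of three forms at all pairs of idempotents. -/
theorem eval_idem (hA : A.IsFreeOn x) (m : A) :
    (∀ (B : InvSemigrp.{u}) (g : A ⟶ B), g (x 0) * g (x 0) = g (x 0) →
      g (x 1) * g (x 1) = g (x 1) → g m = g (x 0)) ∨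
    (∀ (B : InvSemigrp.{u}) (g : A ⟶ B), g (x 0) * g (x 0) = g (x 0) →
      g (x 1) * g (x 1) = g (x 1) → g m = g (x 1)) ∨
    (∀ (B : InvSemigrp.{u}) (g : A ⟶ B), g (x 0) * g (x 0) = g (x 0) →
      g (x 1) * g (x 1) = g (x 1) → g m = g (x 0) * g (x 1)) := by
  have habs : ∀ {B : InvSemigrp.{u}} {e f : B}, e * e = e → f * f = f →
      e * (e * f) = e * f ∧ f * e = e * f ∧ f * (e * f) = e * f ∧ e * f * e = e * f ∧
      e * f * f = e * f ∧ e * f * (e * f) = e * f := by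
    intro B e f he hf
    have c := idem_comm he hf
    refine ⟨by rw [← mul_assoc, he], c.symm, by rw [c, ← mul_assoc, hf], ?_,
      by rw [mul_assoc, hf], mul_idem he hf⟩
    rw [mul_assoc, ← c, ← mul_assoc, he]
  revert m
  refine hA.induction ?_ ?_ ?_
  · intro i
    fin_cases i
    · exact .inl fun B g _ _ => rfl
    · exact .inr (.inl fun B g _ _ => rfl)
  · rintro a b (ha | ha | ha) (hb | hb | hb)
    on_goal 1 =>
      exact .inl fun B g he hf => by rw [hom_mul, ha B g he hf, hb B g he hf, he]
    on_goal 4 =>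
      exact .inr (.inl fun B g he hf => by rw [hom_mul, ha B g he hf, hb B g he hf, hf])
    all_goals
      refine .inr (.inr fun B g he hf => ?_)
      obtain ⟨h1, h2, h3, h4, h5, h6⟩ := habs he hf
      rw [hom_mul, ha B g he hf, hb B g he hf]
      try assumption
  · rintro a (ha | ha | ha)
    · exact .inl fun B g he hf => by rw [hom_inv, ha B g he hf, inv_eq_self he]
    · exact .inr (.inl fun B g he hf => by rw [hom_inv, ha B g he hf, inv_eq_self hf])
    · exact .inr (.inr fun B g he hf => by
        rw [hom_inv, ha B g he hf, inv_eq_self (mul_idem he hf)])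

/-- An inverse semigroup operation on the free inverse semigroup of rank two with the same
inversion, that is natural and has the same idempotents and domains, agrees with the
multiplication at the generators. -/
theorem natural_op_eq_mul (hA : A.IsFreeOn x) (o : A → A → A)
    (hnat : ∀ (φ : A ⟶ A) a b, φ (o a b) = o (φ a) (φ b))
    (hassoc : ∀ a b c, o (o a b) c = o a (o b c)) (hinv : ∀ a b, (o a b)⁻¹ = o b⁻¹ a⁻¹)
    (hreg : ∀ a, o (o a a⁻¹) a = a) (hdom : ∀ a, o a a⁻¹ = a * a⁻¹)
    (hidem : ∀ e f, e * e = e → f * f = f → o e f = e * f) :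
    o (x 0) (x 1) = x 0 * x 1 := by
  obtain ⟨r, hr, hr', hm, hi⟩ := hA.exists_action_fin_three
  have hdom' : ∀ a, o a⁻¹ a = a⁻¹ * a := fun a => by simpa only [inv_inv'] using hdom a⁻¹
  generalize hX : x 0 = X at *
  generalize hY : x 1 = Y at *
  have hf : Y * Y⁻¹ * (Y * Y⁻¹) = Y * Y⁻¹ := mul_inv_idem Y
  have hg : X⁻¹ * X * (X⁻¹ * X) = X⁻¹ * X := inv_mul_idem X
  have hfg := idem_comm hf hg
  have hfi : (Y * Y⁻¹)⁻¹ = Y * Y⁻¹ := inv_eq_self hf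
  -- `d i` is the idempotent `d 0` times the label of the path from `0` to `i`; by `hd`, right
  -- multiplication follows the action.
  let d : Fin 3 → A := ![X * (Y * Y⁻¹) * X⁻¹, X * (Y * Y⁻¹), X * Y]
  have hd : ∀ a i j, r a i j → d i * a = d j ∧ d j * a⁻¹ = d i := by
    refine hA.induction ?_ ?_ ?_
    · intro k i j h
      fin_cases k
      · change r (x 0) i j at h
        rw [hX, hr] at h
        change d i * x 0 = d j ∧ d j * (x 0)⁻¹ = d i
        rw [hX, h.1, h.2]
        refine ⟨?_, rfl⟩
        change X * (Y * Y⁻¹) * X⁻¹ * X = X * (Y * Y⁻¹)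
        rw [mul_assoc, mul_assoc, hfg, ← mul_assoc, ← mul_assoc X, mul_inv_mul']
      · change r (x 1) i j at h
        rw [hY, hr'] at h
        change d i * x 1 = d j ∧ d j * (x 1)⁻¹ = d i
        rw [hY, h.1, h.2]
        refine ⟨?_, ?_⟩
        · change X * (Y * Y⁻¹) * Y = X * Y
          rw [mul_assoc, mul_inv_mul']
        · exact mul_assoc _ _ _
    · intro a b ha hb i j h
      obtain ⟨k, h1, h2⟩ := (hm _ _ _ _).1 h
      rw [mul_inv_rev', ← mul_assoc, ← mul_assoc, (ha _ _ h1).1, (hb _ _ h2).1, (hb _ _ h2).2,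
        (ha _ _ h1).2]
      exact ⟨rfl, rfl⟩
    · intro a ha i j h
      rw [inv_inv']
      exact (ha _ _ ((hi _ _ _).1 h)).symm
  -- `z⁻¹` is determined by the point to which it sends `1`; specializing the generators excludes
  -- the points `1` and `2`.
  have hz : o X (Y * Y⁻¹) = X * (Y * Y⁻¹) := by
    generalize hzdef : o X (Y * Y⁻¹) = z
    have hzi : z⁻¹ = o (Y * Y⁻¹) X⁻¹ := by rw [← hzdef, hinv, hfi]
    have hzz : z⁻¹ * z = X⁻¹ * X * (Y * Y⁻¹) := by
      rw [← hdom', hzi, ← hzdef, hassoc, ← hassoc X⁻¹, hdom', hidem _ _ hg hf,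
        hidem _ _ hf (mul_idem hg hf), ← mul_assoc, hfg, mul_assoc, hf]
    have hznot : z * z ≠ z := by
      intro h
      -- Under `Y ↦ X⁻¹`, `z` becomes `o X (o X⁻¹ X) = X`, which is not idempotent.
      obtain ⟨ψ, h0, h1⟩ := hA.exists_hom X X⁻¹
      rw [hX] at h0
      rw [hY] at h1
      have h2 : ψ z = X := by
        rw [← hzdef, hnat, hom_mul, hom_inv, h0, h1, inv_inv', ← hdom', ← hassoc, hreg]
      have h3 := congrArg ψ h
      rw [hom_mul, h2] at h3
      exact hA.not_idem (hX ▸ h3)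
    obtain ⟨i, hri⟩ : ∃ i, r z⁻¹ 1 i := by
      have h1 : r (z⁻¹ * z) 1 1 := by rw [hzz]; simp [hm, hi, hr, hr']
      obtain ⟨i, h, -⟩ := (hm _ _ _ _).1 h1
      exact ⟨i, h⟩
    have h1 : z⁻¹ = X⁻¹ * d i := by
      rw [← (hd _ _ _ hri).1]
      change z⁻¹ = X⁻¹ * (X * (Y * Y⁻¹) * z⁻¹)
      rw [← mul_assoc, ← mul_assoc, ← hzz, inv_mul_inv]
    fin_cases i
    · change z⁻¹ = X⁻¹ * (X * (Y * Y⁻¹) * X⁻¹) at h1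
      rw [← mul_assoc, ← mul_assoc, ← hfg, mul_assoc, inv_mul_inv] at h1
      rw [← inv_inv' z, h1, mul_inv_rev', inv_inv', hfi]
    · change z⁻¹ = X⁻¹ * (X * (Y * Y⁻¹)) at h1
      rw [← mul_assoc] at h1
      have h2 := mul_idem hg hf
      rw [← h1] at h2
      rw [← inv_eq_self h2, inv_inv'] at h2
      exact absurd h2 hznot
    · change z⁻¹ = X⁻¹ * (X * Y) at h1
      rw [← mul_assoc] at h1
      -- `Y ↦ Y * Y⁻¹` fixes `z` but makes the right side of `h1` idempotent.
      obtain ⟨ψ, h0, h1'⟩ := hA.exists_hom X (Y * Y⁻¹)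
      rw [hX] at h0
      rw [hY] at h1'
      have h2 : ψ z = z := by
        rw [← hzdef, hnat, hom_mul, hom_inv, h0, h1', hfi, hf]
      have h3 := congrArg ψ h1
      rw [hom_mul, hom_mul, hom_inv, hom_inv, h0, h1', h2] at h3
      have h2 := mul_idem hg hf
      rw [← h3] at h2
      rw [← inv_eq_self h2, inv_inv'] at h2
      exact absurd h2 hznot
  have hR : o X Y * (o X Y)⁻¹ = X * (Y * Y⁻¹) * X⁻¹ := by
    have h1 : o X (Y * Y⁻¹) * (o X (Y * Y⁻¹))⁻¹ = o (o X (Y * Y⁻¹)) X⁻¹ := by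
      rw [← hdom, hinv, hfi, ← hassoc, hassoc X, hidem _ _ hf hf, hf]
    rw [← hdom, hinv, ← hassoc, hassoc X, hdom, ← h1, hz, mul_inv_rev', hfi, ← mul_assoc,
      mul_assoc X, hf]
  have hL : (o X Y)⁻¹ * o X Y = Y⁻¹ * (X⁻¹ * X) * Y := by
    -- This substitution turns `o X Y` into its inverse, so `hR` yields the range.
    obtain ⟨ψ, h0, h1⟩ := hA.exists_hom Y⁻¹ X⁻¹
    rw [hX] at h0
    rw [hY] at h1
    have h2 := congrArg ψ hR
    simp only [hom_mul, hom_inv, hnat, h0, h1, hinv, inv_inv'] at h2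
    rw [hinv, h2]
  -- `hR` makes `o X Y` defined at `0`; `hL` puts its value in the image of `Y`, which is `{2}`.
  obtain ⟨k, hk⟩ : ∃ k, r (o X Y) 0 k := by
    have h1 : r (o X Y * (o X Y)⁻¹) 0 0 := by rw [hR]; simp [hm, hi, hr, hr']
    obtain ⟨i, h, -⟩ := (hm _ _ _ _).1 h1
    exact ⟨i, h⟩
  have hk2 : k = 2 := by
    have h1 : r ((o X Y)⁻¹ * o X Y) k k := (hm _ _ _ _).2 ⟨0, (hi _ _ _).2 hk, hk⟩
    rw [hL, mul_assoc, hm] at h1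
    obtain ⟨l, h, -⟩ := h1
    exact ((hr' _ _).1 ((hi _ _ _).1 h)).2
  subst hk2
  have h1 : X * (Y * Y⁻¹) * X⁻¹ * o X Y = X * Y := (hd _ _ _ hk).1
  rwa [← hR, mul_inv_mul'] at h1

end TwoGenerators

end IsFreeOn

end InvSemigrp

/-! ### Natural bijections and the transported operations -/

namespace InvSemigrp

open InverseSemigroup

/-- Bijections `A → Φ A` natural in the object `A`. -/
structure NaturalBijection {P : ObjectProperty InvSemigrp.{u}}
    (Φ : P.FullSubcategory ⥤ P.FullSubcategory) where
  /-- The bijection at an object. -/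
  equiv (A : P.FullSubcategory) : A.obj ≃ (Φ.obj A).obj
  naturality {A B : P.FullSubcategory} (μ : A ⟶ B) (a : A.obj) :
    (Φ.map μ).hom (equiv A a) = equiv B (μ.hom a)

/-- Endofunctors with natural multiplicative bijections compatible with inversion are inner. -/
theorem NaturalBijection.isInnerFunctor {P : ObjectProperty InvSemigrp.{u}}
    {Φ : P.FullSubcategory ⥤ P.FullSubcategory} (s : NaturalBijection Φ)
    (hm : ∀ (A : P.FullSubcategory) (a b : A.obj),
      s.equiv A (a * b) = s.equiv A a * s.equiv A b)
    (hi : ∀ (A : P.FullSubcategory) (a : A.obj), s.equiv A a⁻¹ = (s.equiv A a)⁻¹) :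
    IsInnerFunctor Φ := by
  refine ⟨fun A => P.isoMk (isoOfEquiv (s.equiv A) (hm A) (hi A)), fun {A B} μ => ?_⟩
  rw [Iso.eq_inv_comp]
  exact ObjectProperty.hom_ext P (hom_ext' fun a => s.naturality μ a)

namespace NaturalBijection

variable {P : ObjectProperty InvSemigrp.{u}} {Φ : P.FullSubcategory ⥤ P.FullSubcategory}
  (s : NaturalBijection Φ)

section TwoGenerators

variable {A₂ : P.FullSubcategory} {x : Fin 2 → A₂.obj}

/-- The multiplication of `Φ B`, transported to `B`, is given by a word. -/
theorem mul_eq_word (B : P.FullSubcategory) (g : A₂ ⟶ B) :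
    s.equiv B (g.hom (x 0)) * s.equiv B (g.hom (x 1)) =
      s.equiv B (g.hom ((s.equiv A₂).symm (s.equiv A₂ (x 0) * s.equiv A₂ (x 1)))) := by
  rw [← s.naturality, ← s.naturality, ← s.naturality, Equiv.apply_symm_apply, hom_mul]

/-- By `eval_idem` the word of the transported product is `e`, `f` or `ef`. Projections would
distinguish the two orders of `x 0 * (x 0)⁻¹` and `x 1 * (x 1)⁻¹`, whose images are commuting
idempotents. -/
theorem map_mul_of_idem (hA₂ : A₂.obj.IsFreeOn x) (B : P.FullSubcategory) {e f : B.obj}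
    (he : e * e = e) (hf : f * f = f) : s.equiv B (e * f) = s.equiv B e * s.equiv B f := by
  have hword : ∀ (B : P.FullSubcategory) (e f : B.obj), ∃ g : A₂.obj ⟶ B.obj,
      g (x 0) = e ∧ g (x 1) = f ∧ s.equiv B e * s.equiv B f =
        s.equiv B (g ((s.equiv A₂).symm (s.equiv A₂ (x 0) * s.equiv A₂ (x 1)))) := by
    intro B e f
    obtain ⟨g, rfl, rfl⟩ := hA₂.exists_hom e f
    exact ⟨g, rfl, rfl, s.mul_eq_word B (ObjectProperty.homMk g)⟩
  have hne := hA₂.mul_inv_ne_mul_inv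
  have h0 := mul_inv_idem (x 0)
  have h1 := mul_inv_idem (x 1)
  have hself : ∀ e : A₂.obj, e * e = e → s.equiv A₂ e * s.equiv A₂ e = s.equiv A₂ e := by
    intro e he
    obtain ⟨g, g0, g1, hg⟩ := hword A₂ e e
    rw [hg]
    congr 1
    rcases hA₂.eval_idem ((s.equiv A₂).symm (s.equiv A₂ (x 0) * s.equiv A₂ (x 1))) with h | h | h <;>
      rw [h _ g (by rw [g0, he]) (by rw [g1, he])] <;> simp only [g0, g1, he]
  have hcomm := idem_comm (hself _ h0) (hself _ h1)
  obtain ⟨g, g0, g1, hg⟩ := hword A₂ (x 0 * (x 0)⁻¹) (x 1 * (x 1)⁻¹)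
  obtain ⟨k, k0, k1, hk⟩ := hword A₂ (x 1 * (x 1)⁻¹) (x 0 * (x 0)⁻¹)
  rw [hg, hk] at hcomm
  replace hcomm := (s.equiv A₂).injective hcomm
  obtain ⟨l, rfl, rfl, hl⟩ := hword B e f
  rw [hl]
  congr 1
  rcases hA₂.eval_idem ((s.equiv A₂).symm (s.equiv A₂ (x 0) * s.equiv A₂ (x 1))) with h | h | h
  · rw [h _ g (by rw [g0, h0]) (by rw [g1, h1]), h _ k (by rw [k0, h1]) (by rw [k1, h0]), g0, k0]
      at hcomm
    exact absurd hcomm hne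
  · rw [h _ g (by rw [g0, h0]) (by rw [g1, h1]), h _ k (by rw [k0, h1]) (by rw [k1, h0]), g1, k1]
      at hcomm
    exact absurd hcomm.symm hne
  · rw [h _ l he hf]

/-- A natural bijection compatible with inversion and domains is multiplicative. -/
theorem map_mul (hA₂ : A₂.obj.IsFreeOn x)
    (hi : ∀ (A : P.FullSubcategory) (a : A.obj), s.equiv A a⁻¹ = (s.equiv A a)⁻¹)
    (hd : ∀ (A : P.FullSubcategory) (a : A.obj),
      s.equiv A a * (s.equiv A a)⁻¹ = s.equiv A (a * a⁻¹))
    (B : P.FullSubcategory) (a b : B.obj) :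
    s.equiv B (a * b) = s.equiv B a * s.equiv B b := by
  have key := hA₂.natural_op_eq_mul
    (fun a b => (s.equiv A₂).symm (s.equiv A₂ a * s.equiv A₂ b))
    (fun φ a b => by
      have h : ∀ c, s.equiv A₂ (φ c) = (Φ.map (ObjectProperty.homMk φ)).hom (s.equiv A₂ c) :=
        fun c => (s.naturality (ObjectProperty.homMk φ) c).symm
      rw [Equiv.eq_symm_apply]
      simp only [h, hom_mul, Equiv.apply_symm_apply])
    (fun a b c => by simp only [Equiv.apply_symm_apply, mul_assoc])
    (fun a b => by
      rw [Equiv.eq_symm_apply]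
      simp only [hi, Equiv.apply_symm_apply, mul_inv_rev'])
    (fun a => by
      rw [Equiv.symm_apply_eq]
      simp only [hi, Equiv.apply_symm_apply, mul_inv_mul'])
    (fun a => by rw [Equiv.symm_apply_eq, hi, hd])
    (fun e f he hf => by rw [Equiv.symm_apply_eq, s.map_mul_of_idem hA₂ A₂ he hf])
  obtain ⟨g, rfl, rfl⟩ := hA₂.exists_hom a b
  have := s.mul_eq_word (x := x) B (ObjectProperty.homMk g)
  dsimp only [ObjectProperty.homMk_hom] at this
  rw [this, key, hom_mul]

end TwoGenerators

section Monogenic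

variable {A₀ : P.FullSubcategory} {x : Fin 1 → A₀.obj}

theorem exists_hom_monogenic (hA₀ : A₀.obj.IsFreeOn x) (B : P.FullSubcategory) (b : B.obj) :
    ∃ g : A₀ ⟶ B, g.hom (x 0) = b := by
  obtain ⟨g, hg, -⟩ := hA₀ B.obj fun _ => b
  exact ⟨ObjectProperty.homMk g, hg 0⟩

/-- The endomorphism encoding the transported inversion is involutive. It cannot fix the generator,
whose image is a free generator of `Φ A₀`. -/
theorem map_inv (hA₀ : A₀.obj.IsFreeOn x)
    (hq : (Φ.obj A₀).obj.IsFreeOn fun i => s.equiv A₀ (x i))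
    (B : P.FullSubcategory) (b : B.obj) : s.equiv B b⁻¹ = (s.equiv B b)⁻¹ := by
  obtain ⟨φ, hφ⟩ := exists_hom_monogenic hA₀ A₀ ((s.equiv A₀).symm (s.equiv A₀ (x 0))⁻¹)
  have hinvol : φ.hom (φ.hom (x 0)) = x 0 := by
    apply (s.equiv A₀).injective
    rw [← s.naturality φ, hφ, Equiv.apply_symm_apply, hom_inv, s.naturality, hφ,
      Equiv.apply_symm_apply, inv_inv']
  have h0 : s.equiv A₀ (x 0)⁻¹ = (s.equiv A₀ (x 0))⁻¹ := by
    rcases hA₀.eq_or_eq_inv_of_involutive φ.hom hinvol with h | h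
    · rw [hφ, Equiv.symm_apply_eq] at h
      exact absurd h hq.inv_ne_self
    · rw [← h, hφ, Equiv.apply_symm_apply]
  obtain ⟨g, rfl⟩ := exists_hom_monogenic hA₀ B b
  rw [← hom_inv, ← s.naturality, h0, hom_inv, s.naturality]

/-- `Φ.map g` sends the free generator to an idempotent, so it is constant. -/
theorem idem_of_map_idem (hA₀ : A₀.obj.IsFreeOn x)
    (hq : (Φ.obj A₀).obj.IsFreeOn fun i => s.equiv A₀ (x i))
    (B : P.FullSubcategory) (b : B.obj)
    (h : s.equiv B b * s.equiv B b = s.equiv B b) : b * b = b := by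
  obtain ⟨g, rfl⟩ := exists_hom_monogenic hA₀ B b
  have key : ∀ c, (Φ.map g).hom c = s.equiv B (g.hom (x 0)) := by
    refine hq.induction ?_ ?_ ?_
    · intro i
      rw [Subsingleton.elim i 0, s.naturality]
    · intro a b ha hb
      rw [hom_mul, ha, hb, h]
    · intro a ha
      rw [hom_inv, ha, inv_eq_self h]
  apply (s.equiv B).injective
  rw [← hom_mul, ← s.naturality, key]

/-- A natural bijection preserves domains or exchanges domains and ranges. -/
theorem map_dom_or (hA₀ : A₀.obj.IsFreeOn x)
    (hq : (Φ.obj A₀).obj.IsFreeOn fun i => s.equiv A₀ (x i))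
    {A₂ : P.FullSubcategory} {y : Fin 2 → A₂.obj} (hA₂ : A₂.obj.IsFreeOn y) :
    (∀ (B : P.FullSubcategory) (b : B.obj),
      s.equiv B b * (s.equiv B b)⁻¹ = s.equiv B (b * b⁻¹)) ∨
    (∀ (B : P.FullSubcategory) (b : B.obj),
      s.equiv B b * (s.equiv B b)⁻¹ = s.equiv B (b⁻¹ * b)) := by
  obtain ⟨e, he⟩ := (s.equiv A₀).surjective (s.equiv A₀ (x 0) * (s.equiv A₀ (x 0))⁻¹)
  obtain ⟨ι, hι⟩ := exists_hom_monogenic hA₀ A₀ (x 0)⁻¹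
  have hidem : e * e = e :=
    s.idem_of_map_idem hA₀ hq A₀ e (by rw [he, mul_inv_idem])
  have hιidem : ι.hom e * ι.hom e = ι.hom e := by rw [← hom_mul, hidem]
  have hιe : s.equiv A₀ (ι.hom e) = (s.equiv A₀ (x 0))⁻¹ * s.equiv A₀ (x 0) := by
    rw [← s.naturality, he, hom_mul, hom_inv, s.naturality, hι, s.map_inv hA₀ hq, inv_inv']
  -- In `Φ A₀` every idempotent lies below the image of `e` or of `ι e`; multiplicativity on
  -- idempotents carries this back to `A₀`.
  have hmax : e * (x 0 * (x 0)⁻¹) = x 0 * (x 0)⁻¹ ∨ ι.hom e * (x 0 * (x 0)⁻¹) = x 0 * (x 0)⁻¹ := by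
    refine (hq.mul_inv_mul_or_inv_mul_mul (s.equiv A₀ (x 0 * (x 0)⁻¹))).imp ?_ ?_
    · intro h
      rw [← he, ← s.map_mul_of_idem hA₂ A₀ hidem (mul_inv_idem _)] at h
      exact (s.equiv A₀).injective h
    · intro h
      rw [← hιe, ← s.map_mul_of_idem hA₂ A₀ hιidem (mul_inv_idem _)] at h
      exact (s.equiv A₀).injective h
  refine (hA₀.eq_mul_inv_or_eq_inv_mul ι.hom hι hidem hmax).imp ?_ ?_ <;>
  · rintro rfl B b
    obtain ⟨g, rfl⟩ := exists_hom_monogenic hA₀ B b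
    have h := congrArg (Φ.map g).hom he
    rw [s.naturality] at h
    simp only [hom_mul, hom_inv, s.naturality] at h
    exact h.symm

end Monogenic

/-- A natural bijection composed with inversion. -/
def compInv : NaturalBijection Φ where
  equiv A := (Function.Involutive.toPerm (fun a : A.obj => a⁻¹) inv_inv').trans (s.equiv A)
  naturality μ a := by
    change (Φ.map μ).hom (s.equiv _ a⁻¹) = s.equiv _ (μ.hom a)⁻¹
    rw [s.naturality, hom_inv]

theorem compInv_apply (A : P.FullSubcategory) (a : A.obj) :
    s.compInv.equiv A a = s.equiv A a⁻¹ := rfl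

/-- A full and faithful endofunctor that preserves the free inverse semigroup with one generator
comes with natural bijections. -/
theorem exists_of_iso [Φ.Full] [Φ.Faithful] {A₀ : P.FullSubcategory} {x : Fin 1 → A₀.obj}
    (hA₀ : A₀.obj.IsFreeOn x) (θ : A₀ ≅ Φ.obj A₀) :
    ∃ s : NaturalBijection Φ, (Φ.obj A₀).obj.IsFreeOn fun i => s.equiv A₀ (x i) := by
  have hq := hA₀.of_iso (P.ι.mapIso θ)
  have hq' : (Φ.obj A₀).obj.IsFreeOn fun i => θ.hom.hom (x i) := hq
  have hex : ∀ (A : P.FullSubcategory) (a : A.obj), ∃ g : A₀ ⟶ A, g.hom (x 0) = a :=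
    exists_hom_monogenic hA₀
  -- `ev A a` is the morphism that picks out `a`; the bijection sends `a` to the value of `Φ.map (ev
  -- A a)` at the free generator of `Φ A₀`.
  choose ev hev using hex
  have hevu : ∀ {A : P.FullSubcategory} (g : A₀ ⟶ A), ev A (g.hom (x 0)) = g := by
    intro A g
    refine ObjectProperty.hom_ext P ((hA₀ A.obj fun _ => g.hom (x 0)).unique (fun i => ?_)
      (fun i => ?_)) <;> rw [Subsingleton.elim i 0]
    exact hev A _
  have hbij : ∀ A : P.FullSubcategory,
      Function.Bijective fun a : A.obj => (Φ.map (ev A a)).hom (θ.hom.hom (x 0)) := by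
    intro A
    constructor
    · intro a b hab
      have h : Φ.map (ev A a) = Φ.map (ev A b) := by
        refine ObjectProperty.hom_ext P ((hq' (Φ.obj A).obj fun _ =>
          (Φ.map (ev A b)).hom (θ.hom.hom (x 0))).unique (fun i => ?_) (fun i => ?_)) <;>
          rw [Subsingleton.elim i 0]
        exact hab
      rw [← hev A a, Φ.map_injective h, hev]
    · intro c
      obtain ⟨h, hh, -⟩ := hq' (Φ.obj A).obj fun _ => c
      obtain ⟨g, hg⟩ := Φ.map_surjective (ObjectProperty.homMk h : Φ.obj A₀ ⟶ Φ.obj A)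
      refine ⟨g.hom (x 0), ?_⟩
      dsimp only
      rw [hevu, hg]
      exact hh 0
  refine ⟨⟨fun A => Equiv.ofBijective _ (hbij A), fun {A B} μ a => ?_⟩, ?_⟩
  · change (Φ.map μ).hom ((Φ.map (ev A a)).hom (θ.hom.hom (x 0))) =
      (Φ.map (ev B (μ.hom a))).hom (θ.hom.hom (x 0))
    have h : ev B (μ.hom a) = ev A a ≫ μ := by
      rw [← hevu (ev A a ≫ μ)]
      congr 1
      exact congrArg μ.hom (hev A a).symm
    rw [h, Φ.map_comp]
    rfl
  · convert hq' using 2 with i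
    rw [Subsingleton.elim i 0]
    change (Φ.map (ev A₀ (x 0))).hom (θ.hom.hom (x 0)) = _
    have h : ev A₀ (x 0) = 𝟙 A₀ := hevu (𝟙 A₀)
    rw [h, Φ.map_id]
    rfl

end NaturalBijection

end InvSemigrp

/-! ### Automorphisms are inner -/

theorem IsCategoryAutomorphism.isEquivalence {C : Type u} [Category.{v} C] {Φ : C ⥤ C}
    (h : IsCategoryAutomorphism Φ) : Φ.IsEquivalence := by
  obtain ⟨Ψ, h1, h2⟩ := h
  exact (CategoryTheory.Equivalence.mk Φ Ψ (eqToIso h1.symm) (eqToIso h2)).isEquivalence_functor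

theorem mainTheorem9 (P : ObjectProperty InvSemigrp.{u})
    (A₀ : P.FullSubcategory) (x₀ : Fin 1 → A₀.obj) (hA₀ : A₀.obj.IsFreeOn x₀)
    (A₂ : P.FullSubcategory) (x : Fin 2 → A₂.obj) (hA₂ : A₂.obj.IsFreeOn x)
    (Φ : P.FullSubcategory ⥤ P.FullSubcategory) (hΦ : IsCategoryAutomorphism Φ)
    (hΦ₀ : Nonempty (Φ.obj A₀ ≅ A₀)) (hΦ₂ : Nonempty (Φ.obj A₂ ≅ A₂)) :
    IsInnerFunctor Φ := by
  have := hΦ.isEquivalence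
  obtain ⟨θ⟩ := hΦ₀
  obtain ⟨s, hs⟩ := InvSemigrp.NaturalBijection.exists_of_iso hA₀ θ.symm
  have hi := s.map_inv hA₀ hs
  rcases s.map_dom_or hA₀ hs hA₂ with hd | hd
  · exact s.isInnerFunctor (s.map_mul hA₂ hi hd) hi
  -- Domains and ranges are exchanged; precomposing with inversion swaps them back.
  · have hi' : ∀ (A : P.FullSubcategory) (a : A.obj),
        s.compInv.equiv A a⁻¹ = (s.compInv.equiv A a)⁻¹ := fun A a => hi A a⁻¹
    refine s.compInv.isInnerFunctor (s.compInv.map_mul hA₂ hi' fun A a => ?_) hi'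
    rw [s.compInv_apply, s.compInv_apply, hd, InverseSemigroup.inv_inv',
      InverseSemigroup.inv_eq_self (InverseSemigroup.mul_inv_idem a)]
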